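/- Theorem. Let $R$ be a quasi-Frobenius ring, that is, an associative ring with identity which is left and right artinian and in which $\mathrm{l}(\mathrm{r}(I))=I$ for every left ideal $I$ and $\mathrm{r}(\mathrm{l}(J))=J$ for every right ideal $J$, where $\mathrm{r}(I)=\{x\in R : Ix=0\}$ and $\mathrm{l}(J)=\{x\in R : xJ=0\}$. Let $M$ be a finitely generated unital left $R$-module, and let $M^{*}=\mathrm{Hom}_R(M,R)$ be its $R$-dual, which is a right $R$-module via $(f\cdot r)(m)=f(m)\,r$. For a (left or right) $R$-module $N$ with endomorphism ring $S=\mathrm{End}_R(N)$, call a submodule $K$ of $N$ fully invariant if $f(K)\subseteq K$ for all $f\in S$. The module $N$ is called endo-prime if for every non-zero fully invariant submodule $K$ of $N$ the only $f\in S$ with $f(K)=0$ is $f=0$ (i.e. $\mathrm{Ann}_S(K)=0$). It is called endo-coprime if for every proper fully invariant submodule $K$ of $N$ the only $f\in S$ with $f(N)\subseteq K$ is $f=0$ (i.e. $\mathrm{Ann}_S(N/K)=0$). Then: 1. $M$ is endo-prime as a left $R$-module if and only if $M^{*}$ is endo-coprime as a right $R$-module. 2. $M$ is endo-coprime as a left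 $R$-module if and only if $M^{*}$ is endo-prime as a right $R$-module. -/

import Mathlib

/-- The right annihilator `{x ∈ R | I x = 0}` of a left ideal `I`, as a right ideal of `R`
(a submodule of `R` regarded as a right `R`-module, that is, as an `Rᵐᵒᵖ`-module). -/
def rightAnnihilator {R : Type*} [Ring R] (I : Submodule R R) : Submodule Rᵐᵒᵖ R where
  carrier := {x | ∀ a ∈ I, a * x = 0}
  zero_mem' := fun a _ => mul_zero a
  add_mem' := fun {x y} hx hy a ha => by rw [mul_add, hx a ha, hy a ha, add_zero]
  smul_mem' := fun r x hx a ha => by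
    rw [MulOpposite.smul_eq_mul_unop, ← mul_assoc, hx a ha, zero_mul]

/-- The left annihilator `{x ∈ R | x J = 0}` of a right ideal `J`, as a left ideal of `R`. -/
def leftAnnihilator {R : Type*} [Ring R] (J : Submodule Rᵐᵒᵖ R) : Submodule R R where
  carrier := {x | ∀ a ∈ J, x * a = 0}
  zero_mem' := fun a _ => zero_mul a
  add_mem' := fun {x y} hx hy a ha => by rw [add_mul, hx a ha, hy a ha, add_zero]
  smul_mem' := fun r x hx a ha => by rw [smul_eq_mul, mul_assoc, hx a ha, mul_zero]

/-- A ring is quasi-Frobenius (QF) if it is left and right artinian and satisfies the double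
annihilator conditions: every left ideal `I` equals the left annihilator of its right annihilator,
and every right ideal `J` equals the right annihilator of its left annihilator. -/
structure IsQuasiFrobenius (R : Type*) [Ring R] : Prop where
  left_artinian : IsArtinian R R
  right_artinian : IsArtinian Rᵐᵒᵖ R
  left_right : ∀ I : Submodule R R, leftAnnihilator (rightAnnihilator I) = I
  right_left : ∀ J : Submodule Rᵐᵒᵖ R, rightAnnihilator (leftAnnihilator J) = J

/-- `M` is endo-prime if `Ann_S(K) = 0`, `S = End_R(M)`, for every non-zero fully invariant
submodule `K` of `M`. -/
def IsEndoPrime (R M : Type*) [Ring R] [AddCommGroup M] [Module R M] : Prop :=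
  ∀ K : Submodule R M, K.IsFullyInvariant → K ≠ ⊥ →
    ∀ f : Module.End R M, (∀ x ∈ K, f x = 0) → f = 0

/-- `M` is endo-coprime if `Ann_S(M/K) = 0`, `S = End_R(M)`, for every proper fully invariant
submodule `K` of `M`. An endomorphism `f` annihilates `M/K` when it maps `M` into `K`. -/
def IsEndoCoprime (R M : Type*) [Ring R] [AddCommGroup M] [Module R M] : Prop :=
  ∀ K : Submodule R M, K.IsFullyInvariant → K ≠ ⊤ →
    ∀ f : Module.End R M, (∀ x : M, f x ∈ K) → f = 0

/-- The `R`-dual `M* = Hom_R(M, R)` of a left `R`-module `M`. It is a right `R`-module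
(an `Rᵐᵒᵖ`-module) by `(f · r)(m) = f(m) r`. -/
abbrev RDual (R M : Type*) [Ring R] [AddCommGroup M] [Module R M] : Type _ :=
  M →ₗ[R] R

/-- The right `R`-module structure on the dual is the standard one. -/
theorem RDual.op_smul_apply {R M : Type*} [Ring R] [AddCommGroup M] [Module R M]
    (f : RDual R M) (r : R) (m : M) : (MulOpposite.op r • f) m = f m * r :=
  rfl

/-!
Over a quasi-Frobenius ring the functor `Hom_R(-, R)` is a duality between finitely generated left
and right modules, and this duality exchanges the two conditions.

The ring-theoretic input is that `R` is injective as a left module over itself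
(`IsQuasiFrobenius.baer`). The double annihilator conditions say that a homomorphism from a
principal left ideal to `R` is a right multiplication, and that the right annihilator of an
intersection of two left ideals is the sum of their right annihilators; the latter allows two right
multiplications that agree on `I ∩ J` to be merged into one that works on `I + J`. Since `R` is left
noetherian, Baer's criterion follows.

The double annihilator condition on left ideals then makes `R` an injective cogenerator: a point
outside a submodule `K` of `M` is separated from `K` by a functional (`exists_dual_separating`).
For a finitely generated, hence artinian, module `M` this has three consequences.

* `K ↦ K^⊥` and `L ↦ L^⊥` are inverse bijections between submodules of `M` and of `M*`.
* Every endomorphism of `M*` is the transpose of an endomorphism of `M`, which is the reflexivity of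
  `M`; so `K` is fully invariant exactly when `K^⊥` is.
* `f` kills `K` if and only if its transpose maps `M*` into `K^⊥`, and `f` maps `M` into `K` if and
  only if its transpose kills `K^⊥`.

Hence the endo-prime condition on one side is, term by term, the endo-coprime condition on the other.
-/

/-! ### Self-injectivity of quasi-Frobenius rings -/

section Ring

variable {R : Type*} [Ring R]

/-- Both sides have the left annihilator `I ⊓ J`; the reverse inclusion is formal. -/
theorem rightAnnihilator_inf_le (hR : IsQuasiFrobenius R) (I J : Submodule R R) :
    rightAnnihilator (I ⊓ J) ≤ rightAnnihilator I ⊔ rightAnnihilator J := by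
  rw [← hR.right_left (rightAnnihilator I ⊔ rightAnnihilator J)]
  intro x hx a ha
  refine hx a ⟨?_, ?_⟩
  · rw [← hR.left_right I]
    exact fun b hb => ha b (Submodule.mem_sup_left hb)
  · rw [← hR.left_right J]
    exact fun b hb => ha b (Submodule.mem_sup_right hb)

/-- If every left multiplier killing `a` kills `b`, then `b ∈ aR`, because `aR` is the right
annihilator of its left annihilator. -/
theorem IsQuasiFrobenius.exists_eq_mul (hR : IsQuasiFrobenius R) {a b : R}
    (h : ∀ x, x * a = 0 → x * b = 0) : ∃ c, b = a * c := by
  have hb : b ∈ Submodule.span Rᵐᵒᵖ {a} := by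
    rw [← hR.right_left (Submodule.span Rᵐᵒᵖ {a})]
    exact fun x hx => h x (hx a (Submodule.mem_span_singleton_self a))
  obtain ⟨c, rfl⟩ := Submodule.mem_span_singleton.1 hb
  exact ⟨c.unop, MulOpposite.smul_eq_mul_unop ..⟩

theorem IsQuasiFrobenius.exists_eq_mul_of_fg (hR : IsQuasiFrobenius R) (I : Submodule R R)
    (hI : I.FG) : ∀ f : I →ₗ[R] R, ∃ c, ∀ x : I, f x = x * c := by
  induction I, hI using Submodule.fg_induction with
  | singleton a =>
    intro f
    have ha := Submodule.mem_span_singleton_self (R := R) a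
    obtain ⟨c, hc⟩ := hR.exists_eq_mul (a := a) (b := f ⟨a, ha⟩) fun x hx => by
      have : x • (⟨a, ha⟩ : Submodule.span R {a}) = 0 := Subtype.ext hx
      rw [← smul_eq_mul, ← map_smul, this, map_zero]
    refine ⟨c, fun ⟨x, hx⟩ => ?_⟩
    obtain ⟨r, rfl⟩ := Submodule.mem_span_singleton.1 hx
    change f (r • ⟨a, ha⟩) = r • a * c
    rw [map_smul, hc, smul_eq_mul, smul_eq_mul, mul_assoc]
  | sup I J hI hJ ihI ihJ =>
    intro f
    obtain ⟨c, hc⟩ := ihI (f ∘ₗ Submodule.inclusion le_sup_left)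
    obtain ⟨d, hd⟩ := ihJ (f ∘ₗ Submodule.inclusion le_sup_right)
    have hc' : ∀ x (hx : x ∈ I), f ⟨x, Submodule.mem_sup_left hx⟩ = x * c :=
      fun x hx => hc ⟨x, hx⟩
    have hd' : ∀ x (hx : x ∈ J), f ⟨x, Submodule.mem_sup_right hx⟩ = x * d :=
      fun x hx => hd ⟨x, hx⟩
    have hcd : c - d ∈ rightAnnihilator (I ⊓ J) := fun x hx => by
      rw [mul_sub, ← hc' x hx.1, ← hd' x hx.2, sub_self]
    obtain ⟨u, hu, v, hv, huv⟩ := Submodule.mem_sup.1 (rightAnnihilator_inf_le hR I J hcd)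
    -- `c - u = d + v` is the common multiplier: `u` is invisible on `I` and `v` on `J`.
    refine ⟨c - u, fun ⟨x, hx⟩ => ?_⟩
    obtain ⟨y, hy, z, hz, rfl⟩ := Submodule.mem_sup.1 hx
    have hz' : z * (c - u) = z * d := by
      rw [show c - u = d + v by rw [sub_eq_iff_eq_add, add_assoc, add_comm v, huv]; abel,
        mul_add, hv z hz, add_zero]
    have hsplit : (⟨y + z, hx⟩ : (I ⊔ J : Submodule R R)) =
        ⟨y, Submodule.mem_sup_left hy⟩ + ⟨z, Submodule.mem_sup_right hz⟩ := rfl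
    rw [hsplit, map_add, hc' y hy, hd' z hz]
    change _ = (y + z) * (c - u)
    rw [add_mul, hz', mul_sub, hu y hy, sub_zero]

/-- A quasi-Frobenius ring is left self-injective. -/
theorem IsQuasiFrobenius.baer (hR : IsQuasiFrobenius R) : Module.Baer R R := by
  intro I g
  have : IsArtinianRing R := hR.left_artinian
  obtain ⟨c, hc⟩ := hR.exists_eq_mul_of_fg I (IsNoetherian.noetherian I) g
  exact ⟨LinearMap.toSpanSingleton R R c, fun x hx => (hc ⟨x, hx⟩).symm⟩

end Ring

/-! ### Functionals on modules over quasi-Frobenius rings -/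

section Functionals

variable {R M : Type*} [Ring R] [AddCommGroup M] [Module R M]

theorem exists_dual_ne_zero (hR : IsQuasiFrobenius R) {y : M} (hy : y ≠ 0) :
    ∃ f : RDual R M, f y ≠ 0 := by
  set I : Submodule R R := LinearMap.ker (LinearMap.toSpanSingleton R M y) with hI
  -- The left ideal `I = ann(y)` is proper, so its right annihilator contains some `c ≠ 0`, and
  -- `r y ↦ r c` is a well-defined functional on `R y`.
  obtain ⟨c, hc, hc0⟩ : ∃ c ∈ rightAnnihilator I, c ≠ 0 := by
    by_contra! h
    have h1 : (1 : R) ∈ leftAnnihilator (rightAnnihilator I) := fun c hc => by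
      rw [h c hc, mul_zero]
    rw [hR.left_right, hI, LinearMap.mem_ker, LinearMap.toSpanSingleton_apply, one_smul] at h1
    exact hy h1
  obtain ⟨f, hf⟩ := hR.baer.extension_property
    (I.liftQ (LinearMap.toSpanSingleton R M y) le_rfl)
    (LinearMap.ker_eq_bot.1 (Submodule.ker_liftQ_eq_bot _ _ _ le_rfl))
    (I.liftQ (LinearMap.toSpanSingleton R R c) fun r hr => hc r hr)
  refine ⟨f, ?_⟩
  have h1 : f ((1 : R) • y) = (1 : R) • c := LinearMap.congr_fun hf (Submodule.Quotient.mk 1)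
  rwa [← one_smul R y, h1, one_smul]

/-- Functionals separate points from submodules: `R` is a cogenerator. -/
theorem exists_dual_separating (hR : IsQuasiFrobenius R) (K : Submodule R M) {x : M}
    (hx : x ∉ K) : ∃ f : RDual R M, (∀ k ∈ K, f k = 0) ∧ f x ≠ 0 := by
  obtain ⟨f, hf⟩ := exists_dual_ne_zero hR (y := K.mkQ x) (by simpa using hx)
  refine ⟨f ∘ₗ K.mkQ, fun k hk => ?_, hf⟩
  rw [LinearMap.comp_apply, K.mkQ_apply, (Submodule.Quotient.mk_eq_zero K).2 hk, map_zero]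

theorem eq_of_forall_dual_eq (hR : IsQuasiFrobenius R) {x y : M}
    (h : ∀ g : RDual R M, g x = g y) : x = y := by
  by_contra hxy
  obtain ⟨g, hg⟩ := exists_dual_ne_zero hR (sub_ne_zero.2 hxy)
  exact hg (by rw [map_sub, h, sub_self])

/-- A functional vanishing on the common kernel of finitely many functionals is a combination of
them: it factors through the image of `M` in `R^ι`, and extends to `R^ι` by injectivity. -/
theorem exists_eq_sum_mul (hR : IsQuasiFrobenius R) {ι : Type*} [Fintype ι]
    (g : ι → RDual R M) (f : RDual R M) (h : ∀ x, (∀ i, g i x = 0) → f x = 0) :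
    ∃ c : ι → R, ∀ x, f x = ∑ i, g i x * c i := by
  classical
  obtain ⟨φ, hφ⟩ := hR.baer.extension_property
    ((LinearMap.ker (LinearMap.pi g)).liftQ (LinearMap.pi g) le_rfl)
    (LinearMap.ker_eq_bot.1 (Submodule.ker_liftQ_eq_bot _ _ _ le_rfl))
    ((LinearMap.ker (LinearMap.pi g)).liftQ f fun x hx => h x fun i => congrFun hx i)
  refine ⟨fun i => φ fun j => if i = j then 1 else 0, fun x => ?_⟩
  have hx : φ (LinearMap.pi g x) = f x := LinearMap.congr_fun hφ (Submodule.Quotient.mk x)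
  rw [← hx, LinearMap.pi_apply_eq_sum_univ]
  rfl

/-- In an artinian module the common kernel of a set of functionals is already the common kernel of
finitely many of them. -/
theorem exists_finset_common_kernel [IsArtinian R M] (L : Set (RDual R M)) :
    ∃ F : Finset (RDual R M), ↑F ⊆ L ∧
      ∀ x, (∀ g ∈ F, g x = 0) → ∀ g ∈ L, g x = 0 := by
  classical
  let ker (F : Finset (RDual R M)) : Submodule R M := ⨅ g ∈ F, LinearMap.ker g
  obtain ⟨_, ⟨F, hF, rfl⟩, hmin⟩ := IsArtinian.set_has_minimal
    (ker '' {F | ↑F ⊆ L}) ⟨_, ∅, by simp, rfl⟩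
  refine ⟨F, hF, fun x hx g hg => ?_⟩
  have hle : ker (insert g F) ≤ ker F :=
    biInf_mono fun _ => Finset.mem_insert_of_mem
  have heq : ker (insert g F) = ker F := by
    refine eq_of_le_of_not_lt hle (hmin _ ⟨_, ?_, rfl⟩)
    simpa [Set.insert_subset_iff] using ⟨hg, hF⟩
  have hxF : x ∈ ker F := by simpa [ker] using hx
  rw [← heq] at hxF
  simp only [ker, Submodule.mem_iInf, LinearMap.mem_ker] at hxF
  exact hxF g (Finset.mem_insert_self g F)

/-- On a finite set of functionals, every element of the bidual is an evaluation. Otherwise the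
tuple of its values lies outside the image of `M` in `R^F`, and a functional separating the two
gives a relation between the members of `F` that the element of the bidual violates. -/
theorem exists_eval_eq_on_finset (hR : IsQuasiFrobenius R) (ψ : RDual R M →ₗ[Rᵐᵒᵖ] R)
    (F : Finset (RDual R M)) : ∃ m : M, ∀ g ∈ F, g m = ψ g := by
  classical
  let G : M →ₗ[R] (F → R) := LinearMap.pi fun g => g.1
  suffices h : (fun g : F => ψ g) ∈ LinearMap.range G by
    obtain ⟨m, hm⟩ := h
    exact ⟨m, fun g hg => congrFun hm ⟨g, hg⟩⟩
  by_contra h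
  obtain ⟨φ, hφ, hne⟩ := exists_dual_separating hR _ h
  let c (g : F) : R := φ fun j => if g = j then 1 else 0
  have hrel : ∑ g : F, MulOpposite.op (c g) • g.1 = 0 := by
    ext m
    have := hφ (G m) ⟨m, rfl⟩
    rw [LinearMap.pi_apply_eq_sum_univ] at this
    rw [LinearMap.sum_apply, LinearMap.zero_apply, ← this]
    rfl
  apply hne
  rw [LinearMap.pi_apply_eq_sum_univ]
  have := congrArg ψ hrel
  rw [map_sum, map_zero] at this
  refine (Finset.sum_congr rfl fun g _ => ?_).trans this
  rw [map_smul]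
  rfl

/-- An artinian module over a quasi-Frobenius ring is reflexive. -/
theorem exists_eval_eq (hR : IsQuasiFrobenius R) [IsArtinian R M]
    (ψ : RDual R M →ₗ[Rᵐᵒᵖ] R) : ∃ m : M, ∀ g : RDual R M, g m = ψ g := by
  classical
  -- `F` has zero common kernel, so the values on `F` determine an element of `M`.
  obtain ⟨F, -, hF⟩ := exists_finset_common_kernel (Set.univ : Set (RDual R M))
  obtain ⟨m, hm⟩ := exists_eval_eq_on_finset hR ψ F
  refine ⟨m, fun g => ?_⟩
  obtain ⟨m', hm'⟩ := exists_eval_eq_on_finset hR ψ (insert g F)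
  have := hF (m - m') (fun k hk => by
    rw [map_sub, hm k hk, hm' k (Finset.mem_insert_of_mem hk), sub_self]) g trivial
  rw [map_sub, sub_eq_zero] at this
  rw [this, hm' g (Finset.mem_insert_self g F)]

end Functionals

/-! ### Annihilators and transposes -/

section Duality

variable {R M : Type*} [Ring R] [AddCommGroup M] [Module R M]

/-- The submodule `K^⊥` of functionals in `M*` vanishing on `K`. -/
def perp (K : Submodule R M) : Submodule Rᵐᵒᵖ (RDual R M) where
  carrier := {g | ∀ x ∈ K, g x = 0}
  zero_mem' := fun _ _ => rfl
  add_mem' := fun {f g} hf hg x hx => by rw [LinearMap.add_apply, hf x hx, hg x hx, add_zero]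
  smul_mem' := fun r g hg x hx => by rw [LinearMap.smul_apply, hg x hx, smul_zero]

/-- The submodule `L^⊥` of points of `M` at which all functionals in `L` vanish. -/
def coperp (L : Submodule Rᵐᵒᵖ (RDual R M)) : Submodule R M where
  carrier := {x | ∀ g ∈ L, g x = 0}
  zero_mem' := fun g _ => map_zero g
  add_mem' := fun {x y} hx hy g hg => by rw [map_add, hx g hg, hy g hg, add_zero]
  smul_mem' := fun r x hx g hg => by rw [map_smul, hx g hg, smul_zero]

/-- The transpose `g ↦ g ∘ f` of an endomorphism `f`. -/
def transpose (f : Module.End R M) : Module.End Rᵐᵒᵖ (RDual R M) where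
  toFun g := g ∘ₗ f
  map_add' _ _ := rfl
  map_smul' _ _ := rfl

@[simp]
theorem transpose_apply (f : Module.End R M) (g : RDual R M) (x : M) :
    transpose f g x = g (f x) := rfl

theorem coperp_perp (hR : IsQuasiFrobenius R) (K : Submodule R M) : coperp (perp K) = K := by
  refine le_antisymm (fun x hx => ?_) fun x hx g hg => hg x hx
  by_contra hxK
  obtain ⟨f, hf, hfx⟩ := exists_dual_separating hR K hxK
  exact hfx (hx f hf)

theorem perp_coperp (hR : IsQuasiFrobenius R) [IsArtinian R M]
    (L : Submodule Rᵐᵒᵖ (RDual R M)) : perp (coperp L) = L := by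
  refine le_antisymm (fun f hf => ?_) fun g hg x hx => hx g hg
  obtain ⟨F, hFL, hF⟩ := exists_finset_common_kernel (L : Set (RDual R M))
  obtain ⟨c, hc⟩ := exists_eq_sum_mul hR (fun g : F => g.1) f fun x hx =>
    hf x (hF x fun g hg => hx ⟨g, hg⟩)
  have : f = ∑ g : F, MulOpposite.op (c g) • g.1 := by
    ext x
    rw [hc, LinearMap.sum_apply]
    rfl
  rw [this]
  exact Submodule.sum_mem _ fun g _ => L.smul_mem _ (hFL g.2)

theorem perp_eq_top_iff (hR : IsQuasiFrobenius R) {K : Submodule R M} :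
    perp K = ⊤ ↔ K = ⊥ := by
  refine ⟨fun h => (Submodule.eq_bot_iff K).2 fun x hx => ?_, ?_⟩
  · refine eq_of_forall_dual_eq hR fun g => ?_
    have hg : g ∈ perp K := h ▸ Submodule.mem_top
    rw [hg x hx, map_zero]
  · rintro rfl
    refine eq_top_iff.2 fun g _ x hx => ?_
    rw [(Submodule.mem_bot R).1 hx, map_zero]

theorem perp_eq_bot_iff (hR : IsQuasiFrobenius R) {K : Submodule R M} :
    perp K = ⊥ ↔ K = ⊤ := by
  refine ⟨fun h => ?_, ?_⟩
  · rw [← coperp_perp hR K, h]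
    refine eq_top_iff.2 fun x _ g hg => ?_
    rw [(Submodule.mem_bot Rᵐᵒᵖ).1 hg, LinearMap.zero_apply]
  · rintro rfl
    exact (Submodule.eq_bot_iff _).2 fun g hg => LinearMap.ext fun x => hg x trivial

theorem transpose_eq_zero_iff (hR : IsQuasiFrobenius R) {f : Module.End R M} :
    transpose f = 0 ↔ f = 0 := by
  refine ⟨fun h => LinearMap.ext fun x => eq_of_forall_dual_eq hR fun g => ?_, ?_⟩
  · rw [← transpose_apply, h, LinearMap.zero_apply, LinearMap.zero_apply, LinearMap.zero_apply,
      map_zero]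
  · rintro rfl
    ext g x
    simp

theorem transpose_surjective (hR : IsQuasiFrobenius R) [IsArtinian R M] :
    Function.Surjective (transpose : Module.End R M → Module.End Rᵐᵒᵖ (RDual R M)) := by
  intro φ
  -- `f x` is the point of `M` representing the functional `g ↦ φ g x` on `M*`.
  have h (x : M) : ∃ m : M, ∀ g : RDual R M, g m = φ g x :=
    exists_eval_eq hR
      { toFun := fun g => φ g x
        map_add' := fun a b => by rw [map_add, LinearMap.add_apply]
        map_smul' := fun r a => by rw [map_smul, LinearMap.smul_apply, RingHom.id_apply] }
  choose f hf using h
  refine ⟨{ toFun := f, map_add' := fun x y => ?_, map_smul' := fun r x => ?_ }, ?_⟩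
  · exact eq_of_forall_dual_eq hR fun g => by rw [map_add, hf, hf, hf, map_add]
  · exact eq_of_forall_dual_eq hR fun g => by
      rw [RingHom.id_apply, map_smul, hf, hf, map_smul]
  · ext g x
    exact hf x g

theorem isFullyInvariant_perp_iff (hR : IsQuasiFrobenius R) [IsArtinian R M]
    {K : Submodule R M} : (perp K).IsFullyInvariant ↔ K.IsFullyInvariant := by
  constructor
  · intro h f x hx
    rw [Submodule.mem_comap, ← coperp_perp hR K]
    exact fun g hg => h (transpose f) hg x hx
  · intro h φ g hg x hx
    obtain ⟨f, rfl⟩ := transpose_surjective hR φ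
    exact hg (f x) (h f hx)

theorem forall_transpose_mem_perp_iff (hR : IsQuasiFrobenius R) {K : Submodule R M}
    {f : Module.End R M} : (∀ g, transpose f g ∈ perp K) ↔ ∀ x ∈ K, f x = 0 := by
  refine ⟨fun h x hx => eq_of_forall_dual_eq hR fun g => ?_, fun h g x hx => ?_⟩
  · rw [map_zero]
    exact h g x hx
  · rw [transpose_apply, h x hx, map_zero]

theorem forall_transpose_eq_zero_iff (hR : IsQuasiFrobenius R) {K : Submodule R M}
    {f : Module.End R M} : (∀ g ∈ perp K, transpose f g = 0) ↔ ∀ x, f x ∈ K := by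
  refine ⟨fun h x => ?_, fun h g hg => LinearMap.ext fun x => hg _ (h x)⟩
  rw [← coperp_perp hR K]
  exact fun g hg => LinearMap.congr_fun (h g hg) x

theorem perp_surjective (hR : IsQuasiFrobenius R) [IsArtinian R M] :
    Function.Surjective (perp : Submodule R M → Submodule Rᵐᵒᵖ (RDual R M)) :=
  fun L => ⟨coperp L, perp_coperp hR L⟩

end Duality

theorem mainTheorem1 {R M : Type*} [Ring R] (hR : IsQuasiFrobenius R)
    [AddCommGroup M] [Module R M] [Module.Finite R M] :
    (IsEndoPrime R M ↔ IsEndoCoprime Rᵐᵒᵖ (RDual R M)) ∧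
      (IsEndoCoprime R M ↔ IsEndoPrime Rᵐᵒᵖ (RDual R M)) := by
  have : IsArtinianRing R := hR.left_artinian
  have : IsArtinian R M := inferInstance
  unfold IsEndoPrime IsEndoCoprime
  simp only [(perp_surjective (M := M) hR).forall, (transpose_surjective (M := M) hR).forall,
    isFullyInvariant_perp_iff hR, ne_eq, perp_eq_top_iff hR, perp_eq_bot_iff hR,
    forall_transpose_mem_perp_iff hR, forall_transpose_eq_zero_iff hR, transpose_eq_zero_iff hR,
    and_self]
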